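/- For a metric space $F$, a choice of abstract rationals in $F$ is a family $P=(P(q))_{q\ge 1}$ of subsets of $F$ such that, for each integer $q\ge 1$, $P(q)$ is a maximal $(1/q)$-separated subset of $F$ (distinct points of $P(q)$ are at distance at least $1/q$, and no further point of $F$ can be added). For $t>0$ let $$F_t=\{x\in F:\ \text{for infinitely many } q \text{ there is } p\in P(q) \text{ with } d(p,x)\le q^{-t}\}.$$ If $F$ has Hausdorff dimension $s$, the Dirichlet exponent of $P$ is $$d(P)=\sup\{e>0:\ \text{there is a closed ball } B\subset F \text{ of positive radius with } \mathcal H^s(B\setminus F_e)=0\},$$ where $\mathcal H^s$ is $s$-dimensional Hausdorff measure. **Proposition.** Let $F\subset[0,1]$ be the middle-third Cantor set with the Euclidean distance. Its Hausdorff dimension is $s=\log_3 2$, and for every $d\in[1,1+1/s]$ there is a choice $P$ of abstract rationals in $F$ such that $d(P)=d$ and $$\dim_{\mathrm H}F_t=\frac{d}{t}\,s\qquad\text{for all } t\ge d.$$ -/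

import Mathlib

open MeasureTheory Filter Set
open scoped ENNReal

noncomputable section

namespace AbstractRationals

/-- A set is `δ`-separated if distinct points of it are at distance at least `δ`. -/
def Separated {X : Type*} [MetricSpace X] (δ : ℝ) (A : Set X) : Prop :=
  A.Pairwise fun x y => δ ≤ dist x y

/-- `P` is a choice of abstract rationals in the metric space `X`: for every integer `q ≥ 1`
the set `P q` is a maximal (under inclusion) `1/q`-separated subset of `X`.
The value `P 0` carries no meaning and is never used. -/
def IsChoice {X : Type*} [MetricSpace X] (P : ℕ → Set X) : Prop :=
  ∀ q : ℕ, 1 ≤ q → Maximal (Separated (1 / (q : ℝ))) (P q)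

/-- The set of points `x` such that for infinitely many `q` there is some `p ∈ P q`
with `dist p x ≤ 1 / q ^ t`. -/
def approx {X : Type*} [MetricSpace X] (P : ℕ → Set X) (t : ℝ) : Set X :=
  {x | ∃ᶠ q : ℕ in atTop, ∃ p ∈ P q, dist p x ≤ 1 / (q : ℝ) ^ t}

/-- The Dirichlet exponent: the supremum (in the extended reals) of the exponents `e > 0` for
which `approx P e` contains a ball up to a set of `s`-dimensional Hausdorff measure zero. -/
def dirichletExponent {X : Type*} [MetricSpace X] [MeasurableSpace X] [BorelSpace X]
    (s : ℝ) (P : ℕ → Set X) : EReal :=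
  ⨆ e ∈ {e : ℝ | 0 < e ∧ ∃ x : X, ∃ r : ℝ, 0 < r ∧
    Measure.hausdorffMeasure s (Metric.closedBall x r \ approx P e) = 0}, (e : EReal)

end AbstractRationals

end

/-! Points of the Cantor set are binary sequences, and `n` common digits mean distance at most `3 ^
(-n)`. In `rationals k`, with `k n` close to `(d - 1) * n`, the integers `q` in the upper half of
`[3 ^ (n - 1), 3 ^ n)` prescribe the `k n` digits after the `n`-th. All prescriptions occur because
`2 * 2 ^ k n ≤ 3 ^ n`, which is where `d ≤ 1 + 1 / s` enters. Together these `q` use every left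
endpoint of level about `d * n`, so every exponent `e` with `0 < e < d` approximates every point
(`approx_rationals_eq_univ`).

Conversely, each range `3 ^ n ≤ q < 3 ^ (n + 1)` uses only about `2 ^ (d * n)` points in all.
Covering by balls of radius `3 ^ (-n * t)` gives dimension at most `d / t * s`, and measure zero for
`t > d` (`hausdorffMeasure_approx_rationals_eq_zero`).

For the lower bound, sequences vanishing on a very sparse family of blocks `[n + k n, n * t)` lie in
the approximation set. Their free positions have lower density close to `d / t`, and reading the
free digits in base 2 is a Hölder map onto `[0, 1]`. -/

open scoped NNReal Topology

namespace AbstractRationals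

/-! ### Ternary coding and separation of endpoints -/

section Coding

/-- The point of the Cantor set whose ternary digits are `2` where `b` is true and `0` elsewhere. -/
noncomputable def code (b : ℕ → Bool) : cantorSet := cantorSetEquivNatToBool.symm b

theorem coe_code (b : ℕ → Bool) :
    (code b : ℝ) = Real.ofDigits (fun i ↦ cond (b i) (2 : Fin 3) 0) := rfl

theorem code_surjective : Function.Surjective code := cantorSetEquivNatToBool.symm.surjective

theorem dist_code_le {b c : ℕ → Bool} {n : ℕ} (h : ∀ i < n, b i = c i) :
    dist (code b) (code c) ≤ ((3 : ℝ) ^ n)⁻¹ := by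
  rw [Subtype.dist_eq, Real.dist_eq, coe_code, coe_code]
  exact_mod_cast Real.abs_ofDigits_sub_ofDigits_le (b := 3) fun i hi ↦ by rw [h i hi]

/-- The factor 2 comes from the digits being 0 and 2. It makes points with equal tails twice as
separated as general level-`n` endpoints. -/
theorem exists_int_coe_code (b : ℕ → Bool) (n : ℕ) :
    ∃ z : ℤ, (code b : ℝ) = (2 * z + code fun i ↦ b (i + n)) / 3 ^ n := by
  have key : ∃ z : ℤ, ∑ i ∈ Finset.range n,
      Real.ofDigitsTerm (fun i ↦ cond (b i) (2 : Fin 3) 0) i = 2 * z / 3 ^ n := by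
    induction n with
    | zero => exact ⟨0, by simp⟩
    | succ n ih =>
      obtain ⟨z, hz⟩ := ih
      refine ⟨3 * z + cond (b n) 1 0, ?_⟩
      rw [Finset.sum_range_succ, hz]
      cases h : b n <;> simp [Real.ofDigitsTerm, h] <;> field_simp <;> ring
  obtain ⟨z, hz⟩ := key
  refine ⟨z, ?_⟩
  rw [coe_code, Real.ofDigits_eq_sum_add_ofDigits _ n, hz, coe_code]
  push_cast
  ring

theorem le_dist_code_of_ne {b c : ℕ → Bool} {n : ℕ} (h : ∀ i < n, b i = c i) (hn : b n ≠ c n) :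
    ((3 : ℝ) ^ (n + 1))⁻¹ ≤ dist (code b) (code c) := by
  wlog hb : b n = true ∧ c n = false generalizing b c
  · rw [dist_comm]
    exact this (fun i hi ↦ (h i hi).symm) hn.symm (by grind)
  rw [Subtype.dist_eq, Real.dist_eq, coe_code, coe_code,
    Real.ofDigits_eq_sum_add_ofDigits _ (n + 1),
    Real.ofDigits_eq_sum_add_ofDigits (fun i ↦ cond (c i) (2 : Fin 3) 0) (n + 1),
    Finset.sum_range_succ, Finset.sum_range_succ]
  have : ∑ i ∈ Finset.range n, Real.ofDigitsTerm (fun i ↦ cond (b i) (2 : Fin 3) 0) i =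
      ∑ i ∈ Finset.range n, Real.ofDigitsTerm (fun i ↦ cond (c i) (2 : Fin 3) 0) i :=
    Finset.sum_congr rfl fun i hi ↦ by simp [Real.ofDigitsTerm, h i (Finset.mem_range.mp hi)]
  rw [this]
  refine le_trans ?_ (le_abs_self _)
  have h1 := Real.ofDigits_nonneg (fun i ↦ cond (b (i + (n + 1))) (2 : Fin 3) 0)
  have h2 := Real.ofDigits_le_one (fun i ↦ cond (c (i + (n + 1))) (2 : Fin 3) 0)
  have h3 : (0 : ℝ) < ((3 : ℝ) ^ (n + 1))⁻¹ := by positivity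
  have h4 : (((2 : Fin 3) : ℕ) : ℝ) = 2 := by norm_num
  simp only [Real.ofDigitsTerm, hb.1, hb.2, cond_true, cond_false, h4, Nat.cast_ofNat,
    Fin.val_zero, Nat.cast_zero]
  -- The digit at `n` contributes `2 / 3 ^ (n + 1)`, and the tails cancel at most half of it.
  nlinarith [mul_nonneg h3.le h1, mul_nonneg h3.le (sub_nonneg.2 h2)]

theorem exists_first_ne {b c : ℕ → Bool} (h : b ≠ c) :
    ∃ n, (∀ i < n, b i = c i) ∧ b n ≠ c n := by
  have h' : ∃ n, b n ≠ c n := Function.ne_iff.1 h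
  exact ⟨Nat.find h', fun i hi ↦ not_not.1 (Nat.find_min h' hi), Nat.find_spec h'⟩

/-- Distinct points whose coordinates differ by an integer multiple of `δ` are at distance at least
`δ`. -/
theorem le_dist_of_int_mul {x y : cantorSet} (hxy : x ≠ y) {δ : ℝ} (hδ : 0 ≤ δ) {z : ℤ}
    (h : (x : ℝ) - y = z * δ) : δ ≤ dist x y := by
  have hz : z ≠ 0 := by
    rintro rfl
    exact hxy (Subtype.ext (by simpa [sub_eq_zero] using h))
  rw [Subtype.dist_eq, Real.dist_eq, h, abs_mul, abs_of_nonneg hδ]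
  have : (1 : ℝ) ≤ |(z : ℝ)| := by exact_mod_cast Int.one_le_abs hz
  nlinarith

theorem two_div_le_dist_code {b c : ℕ → Bool} {n : ℕ} (h : ∀ i, n ≤ i → b i = c i)
    (hne : code b ≠ code c) : 2 / (3 : ℝ) ^ n ≤ dist (code b) (code c) := by
  obtain ⟨z, hz⟩ := exists_int_coe_code b n
  obtain ⟨w, hw⟩ := exists_int_coe_code c n
  have : (fun i ↦ b (i + n)) = fun i ↦ c (i + n) := funext fun i ↦ h _ (by omega)
  refine le_dist_of_int_mul hne (by positivity) (z := z - w) ?_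
  rw [hz, hw, this]
  push_cast
  ring

theorem exists_int_coe_code_of_const {b : ℕ → Bool} {n : ℕ} (h : ∀ i, n ≤ i → b i = b n) :
    ∃ z : ℤ, (code b : ℝ) = z * (1 / 3 ^ n) := by
  obtain ⟨z, hz⟩ := exists_int_coe_code b n
  have : (fun i ↦ b (i + n)) = fun _ ↦ b n := funext fun i ↦ h _ (by omega)
  rw [this] at hz
  cases hb : b n with
  | false =>
    refine ⟨2 * z, ?_⟩
    rw [hz, hb]
    simp [coe_code, Real.ofDigits, Real.ofDigitsTerm]
    ring
  | true =>
    refine ⟨2 * z + 1, ?_⟩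
    have h1 : ((code fun _ ↦ true : cantorSet) : ℝ) = 1 :=
      Real.ofDigits_const_last_eq_one' (b := 3) (by norm_num)
    rw [hz, hb, h1]
    push_cast
    ring

theorem one_div_le_dist_code {b c : ℕ → Bool} {n : ℕ} (hb : ∀ i, n ≤ i → b i = b n)
    (hc : ∀ i, n ≤ i → c i = c n) (hne : code b ≠ code c) :
    1 / (3 : ℝ) ^ n ≤ dist (code b) (code c) := by
  obtain ⟨z, hz⟩ := exists_int_coe_code_of_const hb
  obtain ⟨w, hw⟩ := exists_int_coe_code_of_const hc
  refine le_dist_of_int_mul hne (by positivity) (z := z - w) ?_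
  rw [hz, hw]
  push_cast
  ring

end Coding

/-! ### Null sets from summable covers -/

section Hausdorff

variable {X : Type*} [MetricSpace X] [MeasurableSpace X] [BorelSpace X]

/-- A Borel–Cantelli lemma for Hausdorff measures. -/
theorem hausdorffMeasure_eq_zero_of_tsum_ne_top {ι : Type*} [Countable ι] {σ : ℝ} (hσ : 0 < σ)
    (U : ι → Set X) (hU : ∑' i, Metric.ediam (U i) ^ σ ≠ ∞) {S : Set X}
    (hS : ∀ x ∈ S, {i | x ∈ U i}.Infinite) : Measure.hausdorffMeasure σ S = 0 := by
  have hlim := ENNReal.tendsto_tsum_compl_atTop_zero hU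
  -- Each diameter outside `F` is at most the tail sum to the power `1 / σ`, so the mesh of the
  -- cover tends to zero too.
  have hlim' : Tendsto (fun F : Finset ι ↦ (∑' i : {i // i ∉ F}, Metric.ediam (U i) ^ σ) ^ σ⁻¹)
      atTop (𝓝 0) := by
    have := ((ENNReal.continuous_rpow_const (y := σ⁻¹)).tendsto 0).comp hlim
    rwa [ENNReal.zero_rpow_of_pos (inv_pos.2 hσ)] at this
  refine le_antisymm ?_ zero_le
  refine (Measure.hausdorffMeasure_le_liminf_tsum σ S (l := atTop) _ hlim'
    (fun F (i : {i // i ∉ F}) ↦ U i) (Eventually.of_forall fun F i ↦ ?_)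
    (Eventually.of_forall fun F x hx ↦ ?_)).trans hlim.liminf_eq.le
  · rw [ENNReal.le_rpow_inv_iff hσ]
    exact ENNReal.le_tsum (f := fun i : {i // i ∉ F} ↦ Metric.ediam (U i) ^ σ) i
  · obtain ⟨i, hi, hiF⟩ := (hS x hx).exists_notMem_finset F
    exact mem_iUnion.2 ⟨⟨i, hiF⟩, hi⟩

end Hausdorff

/-! ### Cantor subsets with free digits, and sparse blocks -/

section LowerBound

theorem exists_ofDigits_bool_eq {y : ℝ} (hy : y ∈ Icc (0 : ℝ) 1) :
    ∃ b : ℕ → Bool, Real.ofDigits (fun i ↦ cond (b i) (1 : Fin 2) 0) = y := by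
  obtain ⟨a, -, rfl⟩ := Real.ofDigits_SurjOn (b := 2) (by norm_num) hy
  refine ⟨fun i ↦ decide (a i = 1), congrArg _ (funext fun i ↦ ?_)⟩
  change cond (decide (a i = 1)) (1 : Fin 2) 0 = a i
  generalize a i = x
  fin_cases x <;> rfl

/-- Letting the digits at the positions `p j` vary freely and fixing all the others gives a set of
positive `r`-dimensional Hausdorff measure, if the positions `p j` are not too sparse. -/
theorem hausdorffMeasure_range_code_extend_ne_zero {s r B : ℝ} (hs : (3 : ℝ) ^ s = 2) (hr : 0 < r)
    {p : ℕ → ℕ} (hp : StrictMono p) (hpr : ∀ j, r * p j ≤ s * j + B) (a : ℕ → Bool) :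
    Measure.hausdorffMeasure r (range fun b : ℕ → Bool ↦ code (Function.extend p b a)) ≠ 0 := by
  set h : (ℕ → Bool) → cantorSet := fun b ↦ code (Function.extend p b a) with hh
  set β : (ℕ → Bool) → ℝ := fun b ↦ Real.ofDigits (fun i ↦ cond (b i) (1 : Fin 2) 0) with hβ
  have key : ∀ b c, |β b - β c| ≤ (3 : ℝ) ^ (B + r) * dist (h b) (h c) ^ r := by
    intro b c
    rcases eq_or_ne b c with rfl | hbc
    · rw [sub_self, abs_zero]
      positivity
    obtain ⟨j, hj, hne⟩ := exists_first_ne hbc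
    have h1 : |β b - β c| ≤ ((2 : ℝ) ^ j)⁻¹ := by
      exact_mod_cast Real.abs_ofDigits_sub_ofDigits_le (b := 2) fun i hi ↦ by rw [hj i hi]
    have h2 : ((3 : ℝ) ^ (p j + 1))⁻¹ ≤ dist (h b) (h c) := by
      refine le_dist_code_of_ne (fun i hi ↦ ?_) ?_
      · by_cases hi' : ∃ l, p l = i
        · obtain ⟨l, rfl⟩ := hi'
          rw [hp.injective.extend_apply, hp.injective.extend_apply, hj l (hp.lt_iff_lt.1 hi)]
        · rw [Function.extend_apply' _ _ _ hi', Function.extend_apply' _ _ _ hi']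
      · rwa [hp.injective.extend_apply, hp.injective.extend_apply]
    calc |β b - β c| ≤ ((2 : ℝ) ^ j)⁻¹ := h1
      _ = (3 : ℝ) ^ (-(s * j)) := by
        rw [Real.rpow_neg (by norm_num), Real.rpow_mul (by norm_num), hs, Real.rpow_natCast]
      _ ≤ (3 : ℝ) ^ (B + r + -((p j + 1 : ℕ) * r)) := by
        refine Real.rpow_le_rpow_of_exponent_le (by norm_num) ?_
        have := hpr j
        push_cast
        linarith
      _ = (3 : ℝ) ^ (B + r) * (((3 : ℝ) ^ (p j + 1))⁻¹) ^ r := by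
        rw [Real.rpow_add (by norm_num), Real.rpow_neg (by norm_num), Real.rpow_mul (by norm_num),
          Real.rpow_natCast, Real.inv_rpow (by positivity)]
      _ ≤ _ := by gcongr
  -- The choice of preimage is harmless: `key` forces `β` to agree on all preimages of a point.
  set f : cantorSet → ℝ := fun x ↦ β (Function.invFun h x) with hf
  have hfh : ∀ b, f (h b) = β b := by
    intro b
    have h1 := key (Function.invFun h (h b)) b
    rw [Function.invFun_eq (f := h) ⟨b, rfl⟩, dist_self, Real.zero_rpow hr.ne', mul_zero] at h1
    exact sub_eq_zero.1 (abs_nonpos_iff.1 h1)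
  have hol : HolderOnWith (Real.toNNReal ((3 : ℝ) ^ (B + r))) (Real.toNNReal r) f (range h) := by
    rintro _ ⟨b, rfl⟩ _ ⟨c, rfl⟩
    rw [hfh, hfh, edist_dist, edist_dist, Real.coe_toNNReal r hr.le,
      ENNReal.ofReal_rpow_of_nonneg dist_nonneg hr.le]
    change _ ≤ ENNReal.ofReal _ * _
    rw [← ENNReal.ofReal_mul (by positivity)]
    exact ENNReal.ofReal_le_ofReal (key b c)
  intro h0
  have := hol.hausdorffMeasure_image_le (by simpa using hr) (d := 1) zero_le_one
  rw [mul_one, Real.coe_toNNReal r hr.le, h0, mul_zero, hausdorffMeasure_real] at this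
  have hsub : Icc (0 : ℝ) 1 ⊆ f '' range h := by
    intro y hy
    obtain ⟨b, hb⟩ := exists_ofDigits_bool_eq hy
    exact ⟨h b, ⟨b, rfl⟩, (hfh b).trans hb⟩
  have h1 := (measure_mono hsub).trans this
  simp at h1

theorem hausdorffMeasure_closedBall_ne_zero {s : ℝ} (hs : (3 : ℝ) ^ s = 2) (hs0 : 0 < s)
    (x : cantorSet) {r : ℝ} (hr : 0 < r) :
    Measure.hausdorffMeasure s (Metric.closedBall x r) ≠ 0 := by
  obtain ⟨a, rfl⟩ := code_surjective x
  obtain ⟨N, hN⟩ := exists_pow_lt_of_lt_one hr (show (3 : ℝ)⁻¹ < 1 by norm_num)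
  have := hausdorffMeasure_range_code_extend_ne_zero (p := fun j ↦ N + j) (B := s * N) hs hs0
    (fun i j h ↦ by simpa using h) (fun j ↦ by push_cast; linarith) a
  contrapose! this
  refine measure_mono_null ?_ this
  rintro _ ⟨b, rfl⟩
  refine (dist_code_le (n := N) fun i hi ↦ ?_).trans (by rw [← inv_pow]; exact hN.le)
  exact Function.extend_apply' _ _ _ (by rintro ⟨j, rfl⟩; omega)

/-- From a sequence of intervals `[m n, L n)` one can choose a subsequence so sparse that the
complement of the chosen intervals is as dense as a single interval permits. -/
theorem exists_strictMono_avoiding {κ : ℝ} (hκ : 1 ≤ κ) (m L : ℕ → ℕ)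
    (h : ∀ a : ℕ, ∃ n ≥ a, a ≤ m n ∧ m n ≤ L n ∧ a < L n ∧ (L n : ℝ) ≤ κ * (m n - a)) :
    ∃ p : ℕ → ℕ, StrictMono p ∧ (∀ j, (p j : ℝ) ≤ κ * j) ∧
      ∃ᶠ n in atTop, ∀ i, m n ≤ i → i < L n → i ∉ range p := by
  choose g hga hgm hmL hgL hgκ using h
  -- `a (i + 1)` is the end of the block chosen after `a i`; the gap from `a i` up to that block
  -- stays free.
  let a : ℕ → ℕ := fun i ↦ Nat.rec (motive := fun _ ↦ ℕ) 0 (fun _ a ↦ L (g a)) i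
  have ha : ∀ i, a (i + 1) = L (g (a i)) := fun i ↦ rfl
  have ha0 : a 0 = 0 := rfl
  have hmono : StrictMono a := strictMono_nat_of_lt_succ fun i ↦ by rw [ha]; exact hgL _
  let A : ℕ → Prop := fun x ↦ ∀ i, ¬ (m (g (a i)) ≤ x ∧ x < L (g (a i)))
  have hA : ∀ i x, a i ≤ x → x < m (g (a i)) → A x := by
    rintro i x h1 h2 j ⟨h3, h4⟩
    rcases lt_trichotomy j i with hji | rfl | hij
    · have : a (j + 1) ≤ a i := hmono.monotone hji
      rw [ha] at this
      omega
    · omega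
    · have : a (i + 1) ≤ a j := hmono.monotone hij
      have := hgm (a j)
      have := hmL (a i)
      rw [ha] at *
      omega
  have hlt : ∀ i, a i < m (g (a i)) := by
    intro i
    have h1 := hgκ (a i : ℕ)
    have h2 : ((a i : ℕ) : ℝ) < L (g (a i)) := by exact_mod_cast hgL (a i)
    have h3 : (0 : ℝ) ≤ a i := by positivity
    by_contra hcon
    have h4 : ((m (g (a i)) : ℕ) : ℝ) ≤ a i := by exact_mod_cast not_lt.1 hcon
    nlinarith
  have hinf : (Set.ofPred A).Infinite := by
    refine Set.infinite_of_not_bddAbove ?_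
    rintro ⟨M, hM⟩
    have h1 : A (a (M + 1)) := hA (M + 1) _ le_rfl (hlt (M + 1))
    have h2 : a (M + 1) ≤ M := hM h1
    have h3 := hmono.le_apply (x := M + 1)
    omega
  classical
  have hcount : ∀ i x, a i ≤ x → x ≤ m (g (a i)) → Nat.count A (a i) + (x - a i) ≤ Nat.count A x := by
    intro i x h1 h2
    obtain ⟨y, rfl⟩ := Nat.exists_eq_add_of_le h1
    rw [Nat.count_add, Nat.add_sub_cancel_left, add_le_add_iff_left]
    have : Nat.count (fun k ↦ A (a i + k)) y = y :=
      Nat.count_iff_forall.2 fun l hl ↦ hA i _ (by omega) (by omega)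
    omega
  have hdens : ∀ x, A x → (x : ℝ) ≤ κ * Nat.count A x := by
    intro x hx
    obtain ⟨i, hi1, hi2⟩ : ∃ i, a i ≤ x ∧ x < a (i + 1) := by
      have hex : ∃ i, x < a i := ⟨x + 1, hmono.le_apply (x := x + 1)⟩
      have hpos : Nat.find hex ≠ 0 := fun h0 ↦ by
        have := Nat.find_spec hex
        rw [h0, ha0] at this
        omega
      refine ⟨Nat.find hex - 1, not_lt.1 (Nat.find_min hex (by omega)), ?_⟩
      rw [Nat.sub_add_cancel (by omega)]
      exact Nat.find_spec hex
    have hxm : x < m (g (a i)) := by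
      by_contra hcon
      exact hx i ⟨not_lt.1 hcon, hi2⟩
    have h1 := hcount i x hi1 hxm.le
    cases i with
    | zero =>
      have h2 : x ≤ Nat.count A x := by rw [ha0] at h1; omega
      have h3 : (x : ℝ) ≤ Nat.count A x := by exact_mod_cast h2
      nlinarith [show (0 : ℝ) ≤ x by positivity]
    -- The last complete free gap alone has at least `a (i + 1) / κ` positions, and everything from
    -- `a (i + 1)` to `x` is free; earlier gaps are not needed.
    | succ i =>
      have h2 := hcount i (m (g (a i))) (hgm _) le_rfl
      have h3 : Nat.count A (m (g (a i))) ≤ Nat.count A (a (i + 1)) :=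
        Nat.count_monotone _ (hmL _)
      have h4 := hgκ (a i : ℕ)
      have h5 := hgm (a i)
      have h6 : m (g (a i)) + x ≤ Nat.count A x + a i + a (i + 1) := by omega
      have h7 : (m (g (a i)) + x : ℝ) ≤ Nat.count A x + a i + a (i + 1) := by exact_mod_cast h6
      have h8 : (a (i + 1) : ℝ) ≤ x := by exact_mod_cast hi1
      rw [← ha] at h4
      nlinarith
  refine ⟨Nat.nth A, Nat.nth_strictMono hinf, fun j ↦ ?_, ?_⟩
  · have := hdens _ (Nat.nth_mem_of_infinite hinf j)
    rwa [Nat.count_nth_of_infinite hinf] at this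
  · refine frequently_atTop.2 fun N ↦ ⟨g (a N), (hmono.le_apply (x := N)).trans (hga _), ?_⟩
    rintro i h1 h2 ⟨j, rfl⟩
    exact Nat.nth_mem_of_infinite hinf j N ⟨h1, h2⟩

end LowerBound

/-! ### The choice of abstract rationals -/

section Construction

theorem exists_modEq_of_le (a M v : ℕ) (hv : v < M) : ∃ q, a ≤ q ∧ q < a + M ∧ q % M = v := by
  have h := Nat.div_add_mod a M
  have h' := Nat.mod_lt a (Nat.zero_lt_of_lt hv)
  by_cases hva : a % M ≤ v
  · exact ⟨M * (a / M) + v, by omega, by omega, by rw [Nat.mul_add_mod, Nat.mod_eq_of_lt hv]⟩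
  · refine ⟨M * (a / M + 1) + v, ?_, ?_, by rw [Nat.mul_add_mod, Nat.mod_eq_of_lt hv]⟩ <;>
    · rw [mul_add, mul_one]
      omega

theorem exists_testBit_eq {k n : ℕ} (hk : 2 * 2 ^ k ≤ 3 ^ n) (b : ℕ → Bool) :
    ∃ q, 3 ^ n < 2 * q ∧ q < 3 ^ n ∧ ∀ i < k, q.testBit i = b i := by
  -- A window of `2 ^ k` consecutive integers meets every residue, and it fits above `3 ^ n / 2` and
  -- below `3 ^ n`.
  obtain ⟨q, h1, h2, h3⟩ := exists_modEq_of_le ((3 ^ n + 1) / 2) (2 ^ k)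
    (Nat.ofBits fun i : Fin k ↦ b i) (Nat.ofBits_lt_two_pow _)
  have hodd : 3 ^ n % 2 = 1 := Nat.odd_iff.1 (Odd.pow (by decide))
  refine ⟨q, by omega, by omega, fun i hi ↦ ?_⟩
  have := congrArg (fun v ↦ v.testBit i) h3
  simpa [Nat.testBit_mod_two_pow, hi, Nat.testBit_ofBits_lt] using this

/-- For `q` in the upper half of `[3 ^ (n - 1), 3 ^ n)` all points whose digits from the `n`-th on
are the first `k n` binary digits of `q` followed by zeros; for `q` in the lower half, the endpoints
of the intervals of length `3 ^ (1 - n)`. -/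
noncomputable def rationals (k : ℕ → ℕ) (q : ℕ) : Set cantorSet :=
  if 3 ^ (Nat.log 3 q + 1) < 2 * q then
    code '' {b | ∀ i, Nat.log 3 q + 1 ≤ i → b i =
      (decide (i < Nat.log 3 q + 1 + k (Nat.log 3 q + 1)) && q.testBit (i - (Nat.log 3 q + 1)))}
  else code '' {b | ∀ i, Nat.log 3 q ≤ i → b i = b (Nat.log 3 q)}

theorem maximal_separated {X : Type*} [MetricSpace X] {δ : ℝ} {A : Set X} (hA : Separated δ A)
    (h : ∀ x, ∃ p ∈ A, dist x p < δ) : Maximal (Separated δ) A := by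
  refine ⟨hA, fun B hB hAB x hx ↦ ?_⟩
  obtain ⟨p, hp, hxp⟩ := h x
  by_cases hne : x = p
  · rwa [hne]
  · exact absurd (hB hx (hAB hp) hne) (not_le.2 hxp)

/-- With `n = Nat.log 3 q + 1`, equal tails give separation `2 / 3 ^ n`, enough only when `3 ^ n ≤ 2
* q`; smaller `q` need endpoints, separated by `3 ^ (1 - n)`. In both cases the first `n` digits of
any point can be matched, whence maximality. -/
theorem isChoice_rationals (k : ℕ → ℕ) : IsChoice (rationals k) := by
  intro q hq
  have h1 : 3 ^ Nat.log 3 q ≤ q := Nat.pow_log_le_self 3 (by omega)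
  have h2 : q < 3 ^ (Nat.log 3 q + 1) := Nat.lt_pow_succ_log_self (by norm_num) q
  have hq0 : (0 : ℝ) < q := by exact_mod_cast hq
  unfold rationals
  set N := Nat.log 3 q
  have h1' : (3 : ℝ) ^ N ≤ q := by exact_mod_cast h1
  have h2' : (q : ℝ) < 3 ^ (N + 1) := by exact_mod_cast h2
  have h3 : ((3 : ℝ) ^ (N + 1))⁻¹ < 1 / q := by
    rw [inv_eq_one_div]
    exact one_div_lt_one_div_of_lt hq0 h2'
  split_ifs with hc
  · have hc' : (3 : ℝ) ^ (N + 1) < 2 * q := by exact_mod_cast hc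
    refine maximal_separated ?_ fun x ↦ ?_
    · rintro _ ⟨b, hb, rfl⟩ _ ⟨c, hc, rfl⟩ hne
      refine le_trans ?_ (two_div_le_dist_code (n := N + 1)
        (fun i hi ↦ by rw [hb i hi, hc i hi]) hne)
      rw [div_le_div_iff₀ hq0 (by positivity)]
      linarith
    · obtain ⟨b, rfl⟩ := code_surjective x
      refine ⟨_, ⟨fun i ↦ if i < N + 1 then b i else
        (decide (i < N + 1 + k (N + 1)) && q.testBit (i - (N + 1))),
        fun i hi ↦ if_neg (by omega), rfl⟩, (dist_code_le fun i hi ↦ ?_).trans_lt h3⟩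
      rw [if_pos hi]
  · refine maximal_separated ?_ fun x ↦ ?_
    · rintro _ ⟨b, hb, rfl⟩ _ ⟨c, hc, rfl⟩ hne
      refine le_trans ?_ (one_div_le_dist_code hb hc hne)
      exact one_div_le_one_div_of_le (by positivity) h1'
    · obtain ⟨b, rfl⟩ := code_surjective x
      refine ⟨_, ⟨fun i ↦ if i < N then b i else b N, fun i hi ↦ ?_, rfl⟩,
        (dist_code_le fun i hi ↦ ?_).trans_lt h3⟩
      · simp [not_lt.2 hi]
      · rcases Nat.lt_succ_iff_lt_or_eq.1 hi with hi | rfl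
        · rw [if_pos hi]
        · simp

theorem code_mem_approx_rationals {k : ℕ → ℕ} (hk : ∀ n, 1 ≤ n → 2 * 2 ^ k n ≤ 3 ^ n) {t : ℝ}
    (ht : 0 ≤ t) {b : ℕ → Bool}
    (hb : ∃ᶠ n : ℕ in atTop, ∃ L : ℕ, n * t ≤ L ∧ ∀ i, n + k n ≤ i → i < L → b i = false) :
    code b ∈ approx (rationals k) t := by
  refine frequently_atTop.2 fun Q ↦ ?_
  obtain ⟨n, hn, L, hL, hbL⟩ := frequently_atTop.1 hb (Q + 1)
  obtain ⟨q, h1, h2, h3⟩ := exists_testBit_eq (hk n (by omega)) (fun i ↦ b (n + i))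
  -- Combined with `3 ^ n < 2 * q` this gives `q > n`, so `q` is unbounded.
  have h3n : 2 * n ≤ 3 ^ n := by
    have := one_add_mul_le_pow (a := (2 : ℤ)) (by norm_num) n
    norm_num at this
    zify
    linarith
  have hlog : Nat.log 3 q + 1 = n := by
    obtain ⟨m, rfl⟩ : ∃ m, n = m + 1 := ⟨n - 1, by omega⟩
    rw [Nat.log_eq_of_pow_le_of_lt_pow ?_ h2]
    rw [pow_succ] at h1
    omega
  have hq0 : (0 : ℝ) < q := by exact_mod_cast (show 0 < q by omega)
  have h2' : (q : ℝ) ≤ 3 ^ n := by exact_mod_cast h2.le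
  refine ⟨q, by omega, code fun i ↦ if i < n then b i else
    (decide (i < n + k n) && q.testBit (i - n)), ?_, ?_⟩
  · rw [rationals, hlog, if_pos h1]
    exact ⟨_, fun i hi ↦ if_neg (by omega), rfl⟩
  · refine (dist_code_le (n := L) (c := b) fun i hi ↦ ?_).trans ?_
    · split_ifs with hin
      · rfl
      by_cases hik : i < n + k n
      · simp [hik, h3 (i - n) (by omega), Nat.add_sub_cancel' (not_lt.1 hin)]
      · simp [hik, hbL i (not_lt.1 hik) hi]
    · rw [inv_eq_one_div]
      refine one_div_le_one_div_of_le (by positivity) ?_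
      calc (q : ℝ) ^ t ≤ ((3 : ℝ) ^ n) ^ t := by gcongr
        _ = (3 : ℝ) ^ (n * t) := by rw [Real.rpow_mul (by norm_num), Real.rpow_natCast]
        _ ≤ (3 : ℝ) ^ (L : ℝ) := Real.rpow_le_rpow_of_exponent_le (by norm_num) hL
        _ = 3 ^ L := Real.rpow_natCast _ _

/-- The points of `rationals k q` lie among the endpoints of a fixed level. -/
theorem exists_of_mem_rationals {k : ℕ → ℕ} {q : ℕ} {p : cantorSet} (hp : p ∈ rationals k q) :
    ∃ w : Fin (Nat.log 3 q + 1 + k (Nat.log 3 q + 1) + 1) → Bool,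
      p = code fun i ↦ w (Fin.ofNat _ (min i (Nat.log 3 q + 1 + k (Nat.log 3 q + 1)))) := by
  set M := Nat.log 3 q + 1 + k (Nat.log 3 q + 1) with hM
  suffices h : ∃ b : ℕ → Bool, p = code b ∧ ∀ i, M ≤ i → b i = b M by
    obtain ⟨b, rfl, hb⟩ := h
    refine ⟨fun i ↦ b i, congrArg code (funext fun i ↦ ?_)⟩
    change b i = b (Fin.ofNat (M + 1) (min i M))
    rw [Fin.val_ofNat, Nat.mod_eq_of_lt (by omega)]
    rcases le_total i M with h | h
    · rw [min_eq_left h]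
    · rw [min_eq_right h, hb i h]
  unfold rationals at hp
  split_ifs at hp
  · obtain ⟨b, hb, rfl⟩ := hp
    refine ⟨b, rfl, fun i hi ↦ ?_⟩
    rw [hb i (by omega), hb M (by omega)]
    simp [← hM, hi]
  · obtain ⟨b, hb, rfl⟩ := hp
    exact ⟨b, rfl, fun i hi ↦ by rw [hb i (by omega), hb M (by omega)]⟩

end Construction

/-! ### Dimension and Dirichlet exponent -/

section Dimension

variable {s d : ℝ} {k : ℕ → ℕ}

/-- All `q` with the same `Nat.log 3 q` share one finite family of centres, so the number of such
`q` costs nothing. The cover sums are dominated by a geometric series of ratio `2 ^ d * 3 ^ (-(t *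
σ))`. -/
theorem hausdorffMeasure_approx_rationals_eq_zero (hs : (3 : ℝ) ^ s = 2) (hs0 : 0 < s) (hd : 1 ≤ d)
    (hk : ∀ n, (k n : ℝ) ≤ (d - 1) * n) {t σ : ℝ} (ht : 0 < t) (hσ : d / t * s < σ) :
    Measure.hausdorffMeasure σ (approx (rationals k) t) = 0 := by
  have hσ0 : 0 < σ := lt_of_le_of_lt (by positivity) hσ
  let U : (Σ n : ℕ, (Fin (n + 1 + k (n + 1) + 1) → Bool)) → Set cantorSet := fun i ↦
    Metric.closedBall (code fun j ↦ i.2 (Fin.ofNat _ (min j (i.1 + 1 + k (i.1 + 1)))))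
      (((3 : ℝ) ^ i.1) ^ t)⁻¹
  refine hausdorffMeasure_eq_zero_of_tsum_ne_top hσ0 U ?_ fun x hx ↦ ?_
  · set ρ : ℝ := (2 : ℝ) ^ d * (3 : ℝ) ^ (-(t * σ)) with hρ
    have hρ1 : ρ < 1 := by
      rw [hρ, ← hs, ← Real.rpow_mul (by norm_num), ← Real.rpow_add (by norm_num)]
      refine Real.rpow_lt_one_of_one_lt_of_neg (by norm_num) ?_
      rw [div_mul_eq_mul_div, div_lt_iff₀ ht] at hσ
      linarith
    have hbound : ∀ n : ℕ, ∑' w : Fin (n + 1 + k (n + 1) + 1) → Bool,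
        Metric.ediam (U ⟨n, w⟩) ^ σ ≤ ENNReal.ofReal ((2 : ℝ) ^ (1 + d + σ) * ρ ^ n) := by
      intro n
      have h1 : ∀ w, Metric.ediam (U ⟨n, w⟩) ^ σ ≤
          ENNReal.ofReal ((2 * (((3 : ℝ) ^ n) ^ t)⁻¹) ^ σ) := by
        intro w
        rw [← ENNReal.ofReal_rpow_of_nonneg (by positivity) hσ0.le]
        gcongr
        rw [ENNReal.ofReal_mul (by norm_num), ENNReal.ofReal_ofNat]
        simp only [U, ← Metric.closedEBall_ofReal (inv_nonneg.2
          (Real.rpow_nonneg (pow_nonneg (zero_le_three (α := ℝ)) n) t))]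
        exact Metric.ediam_closedEBall_le
      refine (ENNReal.tsum_le_tsum h1).trans ?_
      rw [tsum_fintype, Finset.sum_const, Finset.card_univ, Fintype.card_fun, Fintype.card_bool,
        Fintype.card_fin, nsmul_eq_mul, ← ENNReal.ofReal_natCast,
        ← ENNReal.ofReal_mul (by positivity)]
      refine ENNReal.ofReal_le_ofReal ?_
      have h2 : ((2 ^ (n + 1 + k (n + 1) + 1) : ℕ) : ℝ) ≤ (2 : ℝ) ^ (1 + d + d * n) := by
        push_cast
        rw [← Real.rpow_natCast]
        refine Real.rpow_le_rpow_of_exponent_le (by norm_num) ?_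
        have := hk (n + 1)
        push_cast at this ⊢
        linarith
      calc _ ≤ (2 : ℝ) ^ (1 + d + d * n) * (2 * (((3 : ℝ) ^ n) ^ t)⁻¹) ^ σ := by gcongr
        _ = _ := by
          rw [hρ, mul_pow, ← Real.rpow_natCast ((2 : ℝ) ^ d), ← Real.rpow_natCast ((3 : ℝ) ^ _),
            ← Real.rpow_mul (by norm_num), ← Real.rpow_mul (by norm_num),
            Real.mul_rpow (by norm_num) (by positivity), ← Real.rpow_natCast 3 n,
            ← Real.rpow_mul (by norm_num), ← Real.rpow_neg (by norm_num),
            ← Real.rpow_mul (by norm_num), Real.rpow_add (by norm_num) (1 + d) (d * n),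
            Real.rpow_add (by norm_num) (1 + d) σ]
          rw [show -(n * t) * σ = -(t * σ) * n by ring]
          ring
    rw [ENNReal.tsum_sigma']
    refine ne_top_of_le_ne_top ?_ (ENNReal.tsum_le_tsum hbound)
    exact (Summable.mul_left _ (summable_geometric_of_lt_one (by positivity) hρ1)).tsum_ofReal_ne_top
  · intro hfin
    obtain ⟨M, hM⟩ := (hfin.image Sigma.fst).bddAbove
    obtain ⟨q, hq, p, hp, hpx⟩ := frequently_atTop.1 hx (3 ^ (M + 1))
    obtain ⟨w, rfl⟩ := exists_of_mem_rationals hp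
    have h1 : M + 1 ≤ Nat.log 3 q := Nat.le_log_of_pow_le (by norm_num) hq
    have h2 : (3 : ℝ) ^ Nat.log 3 q ≤ q := by
      exact_mod_cast Nat.pow_log_le_self 3 (Nat.pos_iff_ne_zero.1 (lt_of_lt_of_le (by positivity) hq))
    have h3 : Nat.log 3 q ≤ M := by
      refine hM ⟨⟨Nat.log 3 q, w⟩, ?_, rfl⟩
      change dist x _ ≤ _
      rw [dist_comm, inv_eq_one_div]
      refine hpx.trans (one_div_le_one_div_of_le (by positivity) ?_)
      gcongr
    omega

theorem dimH_approx_rationals_le (hs : (3 : ℝ) ^ s = 2) (hs0 : 0 < s) (hd : 1 ≤ d)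
    (hk : ∀ n, (k n : ℝ) ≤ (d - 1) * n) {t : ℝ} (ht : 0 < t) :
    dimH (approx (rationals k) t) ≤ ENNReal.ofReal (d / t * s) := by
  refine ENNReal.le_of_forall_pos_le_add fun ε hε _ ↦ ?_
  have h0 : 0 ≤ d / t * s := by positivity
  rw [← ENNReal.ofReal_coe_nnreal (p := ε), ← ENNReal.ofReal_add h0 ε.coe_nonneg]
  refine dimH_le_of_hausdorffMeasure_ne_top ?_
  rw [Real.coe_toNNReal _ (by positivity), hausdorffMeasure_approx_rationals_eq_zero hs hs0 hd hk ht
    (by simpa using hε)]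
  exact ENNReal.zero_ne_top

theorem le_dimH_approx_rationals (hs : (3 : ℝ) ^ s = 2) (hs0 : 0 < s) (hd : 1 ≤ d)
    (hk : ∀ n, (k n : ℝ) ≤ (d - 1) * n) (hk' : ∀ n, (d - 1) * n - 2 ≤ k n)
    (hk2 : ∀ n, 1 ≤ n → 2 * 2 ^ k n ≤ 3 ^ n) {t : ℝ} (ht : d ≤ t) :
    ENNReal.ofReal (d / t * s) ≤ dimH (approx (rationals k) t) := by
  have ht0 : 0 < t := by linarith
  refine le_of_forall_lt fun c hc ↦ ?_
  obtain ⟨r, hcr, hr⟩ := ENNReal.lt_iff_exists_nnreal_btwn.1 hc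
  refine hcr.trans_le (le_dimH_of_hausdorffMeasure_ne_zero ?_)
  have hr0 : 0 < (r : ℝ) := by
    have := (zero_le (a := c)).trans_lt hcr
    exact_mod_cast this
  rw [← ENNReal.ofReal_coe_nnreal, ENNReal.ofReal_lt_ofReal_iff (by positivity)] at hr
  rw [div_mul_eq_mul_div, lt_div_iff₀ ht0] at hr
  have hκ : t < s / r * d := by
    rw [div_mul_eq_mul_div, lt_div_iff₀ hr0]
    linarith
  have hκ1 : 1 ≤ s / r := by
    by_contra! hcon
    nlinarith
  set κ := s / r with hκdef
  obtain ⟨p, hp, hpκ, hpa⟩ := exists_strictMono_avoiding hκ1 (fun n ↦ n + k n)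
    (fun n ↦ ⌈n * t⌉₊) fun a ↦ by
      -- The first bound yields `n * t + 1 ≤ κ * (d * n - 2 - a)`, absorbing the ceiling and the
      -- loss of 2 in `hk'`.
      obtain ⟨n, hn⟩ := exists_nat_gt (max ((1 + κ * (2 + a)) / (κ * d - t)) (a + 3))
      have hn1 := (le_max_left _ _).trans_lt hn
      have hn2 := (le_max_right _ _).trans_lt hn
      rw [div_lt_iff₀ (by linarith)] at hn1
      have hna : a + 3 < n := by exact_mod_cast hn2
      have h1 : n + k n ≤ ⌈n * t⌉₊ := by
        have h2 : ((n + k n : ℕ) : ℝ) ≤ ⌈n * t⌉₊ := by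
          push_cast
          have := hk n
          have := Nat.le_ceil (n * t)
          nlinarith
        exact_mod_cast h2
      refine ⟨n, by omega, by omega, h1, by omega, ?_⟩
      have h3 := hk' n
      have h4 := Nat.ceil_lt_add_one (show 0 ≤ n * t by positivity)
      push_cast
      nlinarith
  have hne := hausdorffMeasure_range_code_extend_ne_zero (r := r) (B := 0) hs hr0 hp (fun j ↦ by
    have := mul_le_mul_of_nonneg_left (hpκ j) hr0.le
    rw [hκdef] at this
    rw [add_zero]
    refine this.trans_eq ?_
    field_simp) fun _ ↦ false
  contrapose! hne
  refine measure_mono_null ?_ hne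
  rintro _ ⟨b, rfl⟩
  refine code_mem_approx_rationals hk2 ht0.le (hpa.mono fun n hn ↦ ⟨_, Nat.le_ceil _, ?_⟩)
  exact fun i h1 h2 ↦ Function.extend_apply' _ _ _ (hn i h1 h2)

theorem approx_rationals_eq_univ (hk' : ∀ n, (d - 1) * n - 2 ≤ k n)
    (hk2 : ∀ n, 1 ≤ n → 2 * 2 ^ k n ≤ 3 ^ n) {e : ℝ} (he0 : 0 ≤ e) (he : e < d) :
    approx (rationals k) e = univ := by
  refine eq_univ_of_forall fun x ↦ ?_
  obtain ⟨b, rfl⟩ := code_surjective x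
  refine code_mem_approx_rationals hk2 he0 (Eventually.frequently ?_)
  filter_upwards [eventually_ge_atTop ⌈2 / (d - e)⌉₊] with n hn
  refine ⟨n + k n, ?_, fun i h1 h2 ↦ absurd h2 (not_lt.2 h1)⟩
  have h1 := Nat.ceil_le.1 hn
  rw [div_le_iff₀ (by linarith)] at h1
  have := hk' n
  push_cast
  linarith

theorem approx_one_eq_univ {X : Type*} [MetricSpace X] {P : ℕ → Set X} (hP : IsChoice P) :
    approx P 1 = univ := by
  refine eq_univ_of_forall fun x ↦ Eventually.frequently ?_
  filter_upwards [eventually_ge_atTop 1] with q hq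
  rw [Real.rpow_one]
  by_contra! hcon
  have hmax := (hP q hq).le_of_ge (y := insert x (P q)) ?_ (subset_insert _ _)
  · exact absurd (hcon x (hmax (mem_insert _ _))) (by simp)
  · exact (hP q hq).prop.insert fun y hy _ ↦
      ⟨by rw [dist_comm]; exact (hcon y hy).le, (hcon y hy).le⟩

theorem dirichletExponent_rationals (hs : (3 : ℝ) ^ s = 2) (hs0 : 0 < s) (hd : 1 ≤ d)
    (hk : ∀ n, (k n : ℝ) ≤ (d - 1) * n) (hk' : ∀ n, (d - 1) * n - 2 ≤ k n)
    (hk2 : ∀ n, 1 ≤ n → 2 * 2 ^ k n ≤ 3 ^ n) :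
    dirichletExponent s (rationals k) = (d : EReal) := by
  refine le_antisymm (iSup₂_le ?_) (le_of_forall_lt fun c hc ↦ ?_)
  · rintro e ⟨he0, x, r, hr, h0⟩
    rw [EReal.coe_le_coe_iff]
    by_contra! hde
    have h1 : Measure.hausdorffMeasure s (approx (rationals k) e) = 0 := by
      refine hausdorffMeasure_approx_rationals_eq_zero hs hs0 hd hk he0 ?_
      exact mul_lt_of_lt_one_left hs0 ((div_lt_one he0).2 hde)
    exact hausdorffMeasure_closedBall_ne_zero hs hs0 x hr
      (measure_mono_null (fun y hy ↦ by by_cases h : y ∈ approx (rationals k) e <;> simp [h, hy])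
        (measure_union_null h0 h1))
  · obtain ⟨e, hce, hed⟩ := EReal.lt_iff_exists_real_btwn.1 (max_lt hc
      (show ((0 : ℝ) : EReal) < d by exact_mod_cast (by linarith : (0 : ℝ) < d)))
    have he0 : 0 < e := by exact_mod_cast (le_max_right _ _).trans_lt hce
    refine ((le_max_left _ _).trans_lt hce).trans_le (le_iSup₂ (f := fun (e : ℝ) _ ↦ (e : EReal)) e
      ⟨he0, code fun _ ↦ false, 1, one_pos, ?_⟩)
    rw [approx_rationals_eq_univ hk' hk2 he0.le (by exact_mod_cast hed), sdiff_univ, measure_empty]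

theorem exists_admissible_levels (hs : (3 : ℝ) ^ s = 2) (hs0 : 0 < s)
    (hd : d ∈ Icc 1 (1 + 1 / s)) :
    ∃ k : ℕ → ℕ, (∀ n, (k n : ℝ) ≤ (d - 1) * n) ∧ (∀ n, (d - 1) * n - 2 ≤ k n) ∧
      ∀ n, 1 ≤ n → 2 * 2 ^ k n ≤ 3 ^ n := by
  have hd1 : 0 ≤ d - 1 := sub_nonneg.2 hd.1
  -- Subtracting 1 pays for the factor 2 in `2 * 2 ^ k n`.
  refine ⟨fun n ↦ ⌊(d - 1) * n⌋₊ - 1, fun n ↦ ?_, fun n ↦ ?_, fun n hn ↦ ?_⟩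
  · exact le_trans (by exact_mod_cast Nat.sub_le _ _) (Nat.floor_le (by positivity))
  · have h1 := Nat.lt_floor_add_one ((d - 1) * n)
    have h2 : (⌊(d - 1) * n⌋₊ : ℝ) ≤ (⌊(d - 1) * n⌋₊ - 1 : ℕ) + 1 := by
      exact_mod_cast (by omega : ∀ m : ℕ, m ≤ m - 1 + 1) _
    linarith
  · rcases Nat.eq_zero_or_pos ⌊(d - 1) * n⌋₊ with h0 | h0
    · change 2 * 2 ^ (⌊(d - 1) * n⌋₊ - 1) ≤ 3 ^ n
      rw [h0]
      have := Nat.pow_le_pow_right (show 0 < 3 by norm_num) hn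
      simp at this ⊢
      omega
    · change 2 * 2 ^ (⌊(d - 1) * n⌋₊ - 1) ≤ 3 ^ n
      rw [← pow_succ', Nat.sub_add_cancel h0]
      have h1 := Nat.floor_le (show 0 ≤ (d - 1) * n by positivity)
      have h2 : s * (d - 1) ≤ 1 := by
        have := mul_le_mul_of_nonneg_left (sub_le_iff_le_add'.2 hd.2) hs0.le
        rwa [mul_one_div_cancel hs0.ne'] at this
      have h3 : (2 : ℝ) ^ ⌊(d - 1) * n⌋₊ ≤ 3 ^ n := by
        rw [← hs, ← Real.rpow_natCast, ← Real.rpow_mul (by norm_num), ← Real.rpow_natCast 3 n]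
        refine Real.rpow_le_rpow_of_exponent_le (by norm_num) ?_
        have h4 : (0 : ℝ) ≤ n := by positivity
        nlinarith
      exact_mod_cast h3

end Dimension

end AbstractRationals

/-- The middle-third Cantor set has Hausdorff dimension `s = log 2 / log 3`, and every
`d ∈ [1, 1 + 1/s]` is the Dirichlet exponent of some choice `P` of abstract rationals in it
for which the approximation set of every exponent `t ≥ d` has Hausdorff dimension `(d/t) s`. -/
theorem mainTheorem5 (s : ℝ) (hs : s = Real.logb 3 2) :
    dimH cantorSet = ENNReal.ofReal s ∧
    ∀ d : ℝ, d ∈ Set.Icc 1 (1 + 1 / s) →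
      ∃ P : ℕ → Set cantorSet, AbstractRationals.IsChoice P ∧
        AbstractRationals.dirichletExponent s P = (d : EReal) ∧
        ∀ t : ℝ, d ≤ t → dimH (AbstractRationals.approx P t) = ENNReal.ofReal (d / t * s) := by
  have hs0 : 0 < s := hs ▸ Real.logb_pos (by norm_num) (by norm_num)
  have hs3 : (3 : ℝ) ^ s = 2 := by
    rw [hs, Real.rpow_logb (by norm_num) (by norm_num) (by norm_num)]
  have hdim : ∀ d : ℝ, d ∈ Set.Icc 1 (1 + 1 / s) →
      ∃ P : ℕ → Set cantorSet, AbstractRationals.IsChoice P ∧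
        AbstractRationals.dirichletExponent s P = (d : EReal) ∧
        ∀ t : ℝ, d ≤ t →
          dimH (AbstractRationals.approx P t) = ENNReal.ofReal (d / t * s) := by
    intro d hd
    obtain ⟨k, hk, hk', hk2⟩ := AbstractRationals.exists_admissible_levels hs3 hs0 hd
    exact ⟨AbstractRationals.rationals k, AbstractRationals.isChoice_rationals k,
      AbstractRationals.dirichletExponent_rationals hs3 hs0 hd.1 hk hk' hk2, fun t ht ↦
        le_antisymm (AbstractRationals.dimH_approx_rationals_le hs3 hs0 hd.1 hk (by linarith [hd.1]))
          (AbstractRationals.le_dimH_approx_rationals hs3 hs0 hd.1 hk hk' hk2 ht)⟩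
  refine ⟨?_, hdim⟩
  -- The dimension of the Cantor set is the case `d = t = 1`, where maximality makes the
  -- approximation set everything.
  obtain ⟨P, hP, -, hPt⟩ := hdim 1 ⟨le_rfl, by simpa using hs0.le⟩
  have h1 := hPt 1 le_rfl
  rw [AbstractRationals.approx_one_eq_univ hP, div_one, one_mul] at h1
  rw [← h1, ← (isometry_subtype_coe (s := cantorSet)).dimH_image, Set.image_univ,
    Subtype.range_coe]
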